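/- A 1-limited automaton (1-LA) is a two-way machine with a finite state set $Q$, a finite input alphabet $\Sigma$, and a finite work alphabet that contains $\Sigma$ and two end-markers not in $\Sigma$. On input $w\in\Sigma^*$ the tape holds $w$ in cells $1,\dots,|w|$, the left end-marker in cell $0$ and the right end-marker in cell $|w|+1$; the machine starts in its initial state on cell $1$. In each move it reads a symbol, changes its state, replaces the symbol, and moves one cell to the left or to the right. The content of a cell may be modified only during the first visit to it, and end-markers are never modified nor written. The head never moves to the left of the left end-marker. The input is accepted if some computation passes the right end-marker, entering a final state, and this ends the computation. A two-way deterministic finite automaton (2DFA) is a deterministic machine of this kind that never rewrites, with the same acceptance condition; in both models the transition function may be partial. A 1-LA is once-marking if its work symbols are the symbols $\sigma\in\Sigma$, their marked versions $\dot\sigma$ and the end-markers, and in each computation exactly one cell has its input symbol $\sigma$ replaced by $\dot\sigma$ while all other cells are never changed (on the empty input, and in a computation broken off before it has ended, no cell need be marked). **Theorem.** There is a constant $C$ such that, for every $n\ge 1$ and every finite input alphabet, every deterministic once-marking 1-LA with $n$ states has an equivalent 2DFA (accepting the same language) with at most $Cn^3$ states; this holds even for deterministic 1-LAs that in each computation mark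 at most one cell and change no other. Conversely, there is a constant $C'$ such that every $n$-state 2DFA has an equivalent deterministic once-marking 1-LA with at most $C'n$ states. So deterministic once-marking 1-LAs and 2DFAs are polynomially related in size, measured in the number of states. -/

import Mathlib

universe u v

namespace LimitedAutomata

/-- The symbols that can stand in a tape cell: the two end-markers and the symbols of `β`. -/
inductive TapeSym (β : Type u) : Type u
  | left : TapeSym β
  | right : TapeSym β
  | sym (b : β) : TapeSym β

/-- The two head movements `-1` and `+1`. -/
inductive Dir : Type
  | back : Dir
  | fwd : Dir

/-- The position reached from position `i`; the head cannot pass the left end-marker, which is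
in position `0`. -/
def Dir.move : Dir → ℕ → Option ℕ
  | .back, 0 => none
  | .back, i + 1 => some i
  | .fwd, i => some (i + 1)

/-- The tape holding the word `w`: the left end-marker in position `0`, the letters of `w` in
positions `1, …, |w|`, the right end-marker in position `|w| + 1`. (Positions beyond `|w| + 1`
are never scanned.) -/
def tapeOf {β : Type u} (w : List β) : ℕ → TapeSym β
  | 0 => .left
  | i + 1 => match w[i]? with
    | some b => .sym b
    | none => .right

/-- A (nondeterministic) machine of the kind of a 1-limited automaton, with input alphabet `α`,
state set `Q`, and work alphabet consisting of `α`, the two end-markers, and the further symbols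
in `Δ`. A triple `(p, x, d) ∈ δ q y` means: in state `q` scanning `y`, enter state `p`, replace
`y` by `x` and move the head as told by `d`. End-markers are never modified, and they are never
written in other cells. Rewriting only at first visits is the predicate `OneLimited` below. -/
structure OneLA (α : Type u) (Δ : Type u) (Q : Type v) where
  δ : Q → TapeSym (α ⊕ Δ) → Set (Q × TapeSym (α ⊕ Δ) × Dir)
  start : Q
  final : Set Q
  write_left : ∀ q p x d, (p, x, d) ∈ δ q .left → x = .left
  write_right : ∀ q p x d, (p, x, d) ∈ δ q .right → x = .right
  write_sym : ∀ q b p x d, (p, x, d) ∈ δ q (.sym b) → ∃ b', x = .sym b'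

namespace OneLA

/-- A configuration: state, head position, tape contents. -/
structure Config (α : Type u) (Δ : Type u) (Q : Type v) where
  state : Q
  head : ℕ
  tape : ℕ → TapeSym (α ⊕ Δ)

variable {α : Type u} {Δ : Type u} {Q : Type v}

/-- The initial configuration on input `w`: the head is on cell `1`. -/
def init (M : OneLA α Δ Q) (w : List α) : Config α Δ Q :=
  ⟨M.start, 1, tapeOf (w.map Sum.inl)⟩

/-- One move on an input of length `N`. No move is possible once the head has passed the right
end-marker, and no move leads to the left of the left end-marker. -/
def Step (M : OneLA α Δ Q) (N : ℕ) (c c' : Config α Δ Q) : Prop :=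
  c.head ≤ N + 1 ∧ ∃ x d, (c'.state, x, d) ∈ M.δ c.state (c.tape c.head) ∧
    d.move c.head = some c'.head ∧ c'.tape = Function.update c.tape c.head x

/-- `c 0, c 1, …` is a (possibly partial) computation on input `w`, with `T` moves, where `T` may
be infinite. The values `c t` with `t > T` are irrelevant. -/
def IsComputation (M : OneLA α Δ Q) (w : List α) (c : ℕ → Config α Δ Q) (T : ℕ∞) : Prop :=
  c 0 = M.init w ∧ ∀ t : ℕ, (t : ℕ∞) < T → M.Step w.length (c t) (c (t + 1))

/-- A computation that is infinite or ends in a configuration without a next move. -/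
def IsCompleteComputation (M : OneLA α Δ Q) (w : List α) (c : ℕ → Config α Δ Q) (T : ℕ∞) :
    Prop :=
  M.IsComputation w c T ∧ ∀ t : ℕ, T = t → ∀ c', ¬ M.Step w.length (c t) c'

/-- The accepted language: some computation passes the right end-marker, entering a final
state. -/
def accepts (M : OneLA α Δ Q) : Language α :=
  {w | ∃ (c : ℕ → Config α Δ Q) (t : ℕ), M.IsComputation w c t ∧
    (c t).head = w.length + 2 ∧ (c t).state ∈ M.final}

/-- Each move that modifies the content of a cell is made during the first visit to that cell. -/
def OneLimited (M : OneLA α Δ Q) : Prop :=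
  ∀ (w : List α) (c : ℕ → Config α Δ Q) (T : ℕ∞), M.IsComputation w c T →
    ∀ t : ℕ, (t : ℕ∞) < T → (c (t + 1)).tape (c t).head ≠ (c t).tape (c t).head →
      ∀ s < t, (c s).head ≠ (c t).head

/-- At most one choice in each situation. -/
def Deterministic (M : OneLA α Δ Q) : Prop :=
  ∀ q y, (M.δ q y).Subsingleton

/-- The further work symbols are the marked versions of the input symbols (`Sum.inr a` is the
marked version of `Sum.inl a`), and in each computation all cells but one are never changed, while
the content of that one is either its input symbol or the marked version of it. -/
def MarksAtMostOneCell (M : OneLA α α Q) : Prop :=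
  ∀ (w : List α) (c : ℕ → Config α α Q) (T : ℕ∞), M.IsComputation w c T →
    ∃ j : ℕ, ∀ t : ℕ, (t : ℕ∞) ≤ T → ∀ i : ℕ,
      (c t).tape i = (c 0).tape i ∨
        i = j ∧ ∃ a, (c 0).tape i = .sym (.inl a) ∧ (c t).tape i = .sym (.inr a)

/-- Once marking: at most one cell is marked, and each complete computation on a nonempty input
does mark a cell (on the empty input there is no cell that could be marked). -/
def OnceMarking (M : OneLA α α Q) : Prop :=
  M.MarksAtMostOneCell ∧
    ∀ (w : List α) (c : ℕ → Config α α Q) (T : ℕ∞), w ≠ [] → M.IsCompleteComputation w c T →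
      ∃ t : ℕ, (t : ℕ∞) ≤ T ∧ ∃ i a, (c t).tape i = .sym (.inr a)

end OneLA

/-- A two-way deterministic finite automaton with input alphabet `α` and state set `Q`; its
transition function may be partial. -/
structure TwoDFA (α : Type u) (Q : Type v) where
  δ : Q → TapeSym α → Option (Q × Dir)
  start : Q
  final : Set Q

namespace TwoDFA

variable {α : Type u} {Q : Type v}

/-- One move on input `w`; a configuration is a pair of a state and a head position. No move is
possible once the head has passed the right end-marker, and no move leads to the left of the left
end-marker. -/
def Step (B : TwoDFA α Q) (w : List α) (c c' : Q × ℕ) : Prop :=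
  c.2 ≤ w.length + 1 ∧ ∃ d, B.δ c.1 (tapeOf w c.2) = some (c'.1, d) ∧ d.move c.2 = some c'.2

/-- The accepted language: starting on cell `1`, the computation passes the right end-marker,
entering a final state. -/
def accepts (B : TwoDFA α Q) : Language α :=
  {w | ∃ q ∈ B.final, Relation.ReflTransGen (B.Step w) (B.start, 1) (q, w.length + 2)}

end TwoDFA

end LimitedAutomata

/-! From a machine that marks at most one cell to a two-way automaton. Before the mark, the machine
acts as a 2DFA, `silent`, whose transitions are its non-writing moves. If the mark is made in state
`q` on cell `j`, then `(q, j)` is the configuration in which the run of `silent` from the start gets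
stuck. The simulator cannot store `j`, but it can store `q` together with the current state `p`. A
scanned cell `i` whose input symbol is not rewritten in state `q` is not the marked one. Otherwise
`(q, i)` also halts for `silent`, and since a deterministic run has at most one halting
configuration, `i = j` exactly when `(q, i)` is reachable from the start (`halting_unique`).

Reachability is decided by searching backwards from `(q, i)`, as in Sipser's method for making
space-bounded machines halt. Since `(q, i)` halts, the configurations leading to it contain no
cycle, so they form a finite tree (`acc_of_halting`), which is traversed depth-first without a
stack: a forward move of `silent` leads back to the parent, and the number of the predecessor just
tried is read off from that move. If the search fails, it ends at the root; if the start is found,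
rerunning `silent` leads to the root again. In both cases the root is recognized, and `q` recovered,
because `silent` has no move there. Hence `q` need not be kept during the search. Its states hold
only `p`, the state `r` of the visited node and one of about `2n` predecessor numbers, which gives a
cubic bound.

Conversely, a 2DFA becomes once-marking by marking the first cell in its first move and ignoring the
mark afterwards; two extra states suffice. -/

namespace LimitedAutomata

open Relation

/-! ### Runs of a deterministic relation and their halting points. -/

section Deterministic

variable {X : Type*} {r : X → X → Prop}

theorem reaches_halting (hr : Relator.RightUnique r) {a b c : X} (hab : ReflTransGen r a b)
    (hac : ReflTransGen r a c) (hc : ∀ d, ¬ r c d) : ReflTransGen r b c := by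
  rcases ReflTransGen.total_of_right_unique hr hab hac with h | h
  · exact h
  · rcases h.cases_head with rfl | ⟨d, hd, _⟩
    · exact .refl
    · exact absurd hd (hc d)

/-- This identifies the marked cell: two halting configurations reached from the start coincide, and
so do their head positions. -/
theorem halting_unique (hr : Relator.RightUnique r) {a b c : X} (hab : ReflTransGen r a b)
    (hac : ReflTransGen r a c) (hb : ∀ d, ¬ r b d) (hc : ∀ d, ¬ r c d) : b = c := by
  rcases (reaches_halting hr hab hac hc).cases_head with h | ⟨d, hd, _⟩
  · exact h
  · exact absurd hd (hb d)

/-- No element from which a halting one is reached lies on a cycle. -/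
theorem not_transGen_self (hr : Relator.RightUnique r) {ρ u : X} (hρ : ∀ d, ¬ r ρ d)
    (hu : ReflTransGen r u ρ) : ¬ TransGen r u u := by
  induction hu using ReflTransGen.head_induction_on with
  | refl =>
    intro h
    obtain ⟨d, hd, _⟩ := TransGen.head'_iff.1 h
    exact hρ d hd
  | head huv _ ih =>
    intro h
    -- By determinism a cycle through an element also passes through its only successor, so it can
    -- be pushed forward to the halting element.
    obtain ⟨d, hd, hdu⟩ := TransGen.head'_iff.1 h
    obtain rfl := hr huv hd
    exact ih (TransGen.tail' hdu huv)

/-- On the finite set of ancestors of `ρ` the transitive closure of `r` is irreflexive, hence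
well-founded. This is what makes the backward search from `ρ` terminate. -/
theorem acc_of_halting (hr : Relator.RightUnique r) {ρ : X} (hρ : ∀ d, ¬ r ρ d)
    (hfin : {u | ReflTransGen r u ρ}.Finite) : Acc r ρ := by
  let T := {u // ReflTransGen r u ρ}
  have : Finite T := hfin
  let s : T → T → Prop := fun x y => TransGen r x.1 y.1
  have : IsTrans T s := ⟨fun _ _ _ h h' => TransGen.trans h h'⟩
  have : Std.Irrefl s := ⟨fun x => not_transGen_self hr hρ x.2⟩
  have wf : WellFounded s := Finite.wellFounded_of_trans_of_irrefl s
  have key : ∀ x : T, Acc r x.1 := fun x => by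
    induction x using wf.induction with
    | _ x ih =>
      exact Acc.intro _ fun y hy => ih ⟨y, ReflTransGen.head hy x.2⟩ (TransGen.single hy)
  exact key ⟨ρ, .refl⟩

end Deterministic

/-! ### Tapes and head movements. -/

section Tape

variable {β γ : Type*}

/-- Relabelling of the non-marker symbols. -/
def TapeSym.map (f : β → γ) : TapeSym β → TapeSym γ
  | .left => .left
  | .right => .right
  | .sym b => .sym (f b)

theorem tapeOf_map (f : β → γ) (w : List β) (i : ℕ) :
    tapeOf (w.map f) i = (tapeOf w i).map f := by
  cases i with
  | zero => rfl
  | succ i => cases h : w[i]? <;> simp [tapeOf, h, TapeSym.map]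

theorem tapeOf_eq_left {w : List β} {i : ℕ} : tapeOf w i = .left ↔ i = 0 := by
  cases i with
  | zero => simp [tapeOf]
  | succ i => cases h : w[i]? <;> simp [tapeOf, h]

theorem tapeOf_eq_right {w : List β} {i : ℕ} : tapeOf w i = .right ↔ w.length + 1 ≤ i := by
  cases i with
  | zero => simp [tapeOf]
  | succ i =>
    cases h : w[i]? with
    | none =>
      have := List.getElem?_eq_none_iff.1 h
      simpa [tapeOf, h] using this
    | some b =>
      obtain ⟨hi, -⟩ := List.getElem?_eq_some_iff.1 h
      simp [tapeOf, hi]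

/-- The opposite direction. -/
def Dir.opp : Dir → Dir
  | .back => .fwd
  | .fwd => .back

/-- No cell is left in direction `d` by a move that arrives at a cell containing `y`. -/
def Dir.Blocked : Dir → TapeSym β → Prop
  | .fwd, y => y = .left
  | .back, y => y = .right

theorem Dir.move_injective {d : Dir} {i j k : ℕ} (hi : d.move i = some k)
    (hj : d.move j = some k) : i = j := by
  cases d <;> cases i <;> cases j <;> simp [Dir.move] at hi hj ⊢ <;> omega

theorem Dir.exists_of_not_blocked {d : Dir} {w : List β} {i : ℕ} (hi : i ≤ w.length + 1)
    (h : ¬ d.Blocked (tapeOf w i)) :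
    ∃ j ≤ w.length + 1, d.opp.move i = some j ∧ d.move j = some i := by
  cases d with
  | fwd =>
    rw [Dir.Blocked, tapeOf_eq_left] at h
    obtain ⟨j, rfl⟩ := Nat.exists_eq_succ_of_ne_zero h
    exact ⟨j, by omega, rfl, rfl⟩
  | back =>
    rw [Dir.Blocked, tapeOf_eq_right] at h
    exact ⟨i + 1, by omega, rfl, rfl⟩

theorem Dir.not_blocked {d : Dir} {w : List β} {i j : ℕ} (hj : j ≤ w.length + 1)
    (h : d.move j = some i) : ¬ d.Blocked (tapeOf w i) := by
  cases d with
  | fwd =>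
    rw [Dir.Blocked, tapeOf_eq_left]
    simp only [Dir.move, Option.some.injEq] at h
    omega
  | back =>
    rw [Dir.Blocked, tapeOf_eq_right]
    cases j with
    | zero => simp [Dir.move] at h
    | succ j =>
      simp only [Dir.move, Option.some.injEq] at h
      omega

/-- The two directions as truth values. -/
def Dir.equivBool : Dir ≃ Bool where
  toFun d := match d with
    | .back => false
    | .fwd => true
  invFun b := match b with
    | false => .back
    | true => .fwd
  left_inv d := by cases d <;> rfl
  right_inv b := by cases b <;> rfl

instance : Finite Dir := Finite.of_equiv Bool Dir.equivBool.symm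

theorem card_dir : Nat.card Dir = 2 := by
  rw [Nat.card_congr Dir.equivBool]
  simp

end Tape

/-! ### Two-way automata: determinism, finiteness of backward search, renaming of states. -/

namespace TwoDFA

variable {α : Type u} {Q : Type v}

theorem step_rightUnique (B : TwoDFA α Q) (w : List α) : Relator.RightUnique (B.Step w) := by
  rintro ⟨q, i⟩ ⟨p, j⟩ ⟨p', j'⟩ ⟨_, d, h, hm⟩ ⟨_, d', h', hm'⟩
  simp only at h h' hm hm'
  rw [h] at h'
  simp only [Option.some.injEq, Prod.mk.injEq] at h'
  obtain ⟨rfl, rfl⟩ := h'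
  rw [hm] at hm'
  simp_all

theorem acc_of_halting [Finite Q] (B : TwoDFA α Q) {w : List α} {c : Q × ℕ}
    (hc : ∀ c', ¬ B.Step w c c') (hi : c.2 ≤ w.length + 1) : Acc (B.Step w) c := by
  refine LimitedAutomata.acc_of_halting (B.step_rightUnique w) hc ?_
  refine ((Set.finite_univ (α := Q)).prod (Set.finite_Iic (w.length + 1))).subset ?_
  intro u hu
  rcases ReflTransGen.cases_head hu with rfl | ⟨d, hd, _⟩
  · exact ⟨trivial, hi⟩
  · exact ⟨trivial, hd.1⟩

/-- Renaming of the states. -/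
def reindex {Q' : Type*} (B : TwoDFA α Q) (e : Q ≃ Q') : TwoDFA α Q' where
  δ q y := (B.δ (e.symm q) y).map fun t => (e t.1, t.2)
  start := e B.start
  final := e.symm ⁻¹' B.final

theorem accepts_reindex {Q' : Type*} (B : TwoDFA α Q) (e : Q ≃ Q') :
    (B.reindex e).accepts = B.accepts := by
  ext w
  constructor
  · rintro ⟨q, hq, h⟩
    refine ⟨e.symm q, hq, ?_⟩
    have := ReflTransGen.lift (p := B.Step w) (fun c : Q' × ℕ => (e.symm c.1, c.2)) ?_ _ _ h
    · simpa [reindex, Function.onFun] using this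
    · rintro ⟨a, i⟩ ⟨b, j⟩ ⟨hi, d, hd, hm⟩
      obtain ⟨⟨p, d'⟩, ht, h'⟩ := Option.map_eq_some_iff.1 hd
      obtain ⟨rfl, rfl⟩ := Prod.mk.inj h'
      exact ⟨hi, d', by simpa using ht, hm⟩
  · rintro ⟨q, hq, h⟩
    refine ⟨e q, by simpa [reindex] using hq, ?_⟩
    refine ReflTransGen.lift (p := (B.reindex e).Step w) (fun c : Q × ℕ => (e c.1, c.2)) ?_ _ _ h
    rintro ⟨a, i⟩ ⟨b, j⟩ ⟨hi, d, hd, hm⟩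
    simp only at hd
    exact ⟨hi, d, by simp [reindex, hd], hm⟩

end TwoDFA

/-- A two-way deterministic finite automaton that may also leave its head where it is. -/
structure StayDFA (α : Type u) (Q : Type v) where
  δ : Q → TapeSym α → Option (Q × Option Dir)
  start : Q
  final : Set Q

/-! ### Removing stationary moves without adding states. -/

namespace StayDFA

variable {α : Type u} {Q : Type v}

/-- The position reached by a move that may be stationary. -/
def moveHead : Option Dir → ℕ → Option ℕ
  | none, i => some i
  | some d, i => d.move i

/-- One move on input `w`. -/
def Step (B : StayDFA α Q) (w : List α) (c c' : Q × ℕ) : Prop :=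
  c.2 ≤ w.length + 1 ∧
    ∃ d, B.δ c.1 (tapeOf w c.2) = some (c'.1, d) ∧ moveHead d c.2 = some c'.2

/-- The accepted language. -/
def accepts (B : StayDFA α Q) : Language α :=
  {w | ∃ q ∈ B.final, ReflTransGen (B.Step w) (B.start, 1) (q, w.length + 2)}

theorem step_rightUnique (B : StayDFA α Q) (w : List α) : Relator.RightUnique (B.Step w) := by
  rintro ⟨q, i⟩ ⟨p, j⟩ ⟨p', j'⟩ ⟨_, d, h, hm⟩ ⟨_, d', h', hm'⟩
  simp only at h h' hm hm'
  rw [h] at h'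
  simp only [Option.some.injEq, Prod.mk.injEq] at h'
  obtain ⟨rfl, rfl⟩ := h'
  rw [hm] at hm'
  simp_all

theorem not_step_of_passed (B : StayDFA α Q) (w : List α) (q : Q) (c : Q × ℕ) :
    ¬ B.Step w (q, w.length + 2) c := fun h => by
  have := h.1
  simp at this

/-- After stationary moves on `y`, the state and the move given by `t` are reached. -/
def Leads (B : StayDFA α Q) (y : TapeSym α) (q : Q) (t : Q × Dir) : Prop :=
  ∃ q', ReflTransGen (fun p p' => B.δ p y = some (p', none)) q q' ∧
    B.δ q' y = some (t.1, some t.2)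

theorem Leads.unique {B : StayDFA α Q} {y : TapeSym α} {q : Q} {t t' : Q × Dir}
    (h : B.Leads y q t) (h' : B.Leads y q t') : t = t' := by
  obtain ⟨p, hp, ht⟩ := h
  obtain ⟨p', hp', ht'⟩ := h'
  have hr : Relator.RightUnique fun p p' => B.δ p y = some (p', none) := by
    intro a b c hb hc
    rw [hb] at hc
    simpa using hc
  have := halting_unique hr hp hp' (by simp [ht]) (by simp [ht'])
  subst this
  rw [ht] at ht'
  simp only [Option.some.injEq, Prod.mk.injEq] at ht'
  exact Prod.ext ht'.1 ht'.2

open Classical in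
/-- Elimination of the stationary moves. -/
noncomputable def toTwoDFA (B : StayDFA α Q) : TwoDFA α Q where
  δ q y := if h : ∃ t, B.Leads y q t then some h.choose else none
  start := B.start
  final := B.final

theorem toTwoDFA_δ (B : StayDFA α Q) {q : Q} {y : TapeSym α} {t : Q × Dir} :
    B.toTwoDFA.δ q y = some t ↔ B.Leads y q t := by
  simp only [toTwoDFA]
  split_ifs with h
  · rw [Option.some.injEq]
    exact ⟨fun e => e ▸ h.choose_spec, fun h' => h.choose_spec.unique h'⟩
  · simp only [false_iff]
    exact fun h' => h ⟨t, h'⟩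

theorem accepts_toTwoDFA (B : StayDFA α Q) : B.toTwoDFA.accepts = B.accepts := by
  ext w
  constructor
  · rintro ⟨q, hq, h⟩
    refine ⟨q, hq, ?_⟩
    refine ReflTransGen.lift' id ?_ _ _ h
    rintro ⟨a, i⟩ ⟨b, j⟩ ⟨hi, d, hd, hm⟩
    obtain ⟨q', hs, ht⟩ := B.toTwoDFA_δ.1 hd
    refine ReflTransGen.tail (b := (q', i)) ?_ ⟨hi, some d, ht, hm⟩
    exact ReflTransGen.lift (fun q => (q, i)) (fun a b hab => ⟨hi, none, hab, rfl⟩) _ _ hs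
  · rintro ⟨q, hq, h⟩
    refine ⟨q, hq, ?_⟩
    change ReflTransGen _ (B.start, 1) _
    generalize (B.start, 1) = c at h
    induction h using ReflTransGen.head_induction_on with
    | refl => exact .refl
    | @head a b hab _ ih =>
      obtain ⟨a, i⟩ := a
      obtain ⟨b, j⟩ := b
      obtain ⟨hi, d, hd, hm⟩ := hab
      cases d with
      | some d => exact ReflTransGen.head ⟨hi, d, B.toTwoDFA_δ.2 ⟨a, .refl, hd⟩, hm⟩ ih
      | none =>
        simp only [moveHead, Option.some.injEq] at hm
        subst hm
        -- The stationary move is absorbed into the next genuine move. There is one, because the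
        -- head has not yet passed the right end-marker.
        rcases ih.cases_head with h | ⟨⟨c, k⟩, ⟨_, d, hd', hm⟩, hc⟩
        · simp only [Prod.mk.injEq] at h
          simp only at hi
          omega
        · obtain ⟨q', hs, ht⟩ := B.toTwoDFA_δ.1 hd'
          exact ReflTransGen.head ⟨hi, d, B.toTwoDFA_δ.2 ⟨q', .head hd hs, ht⟩, hm⟩ hc

end StayDFA

namespace OneLA

/-! ### Computations as reachability, and moves as a partial function. -/

section Runs

variable {α : Type u} {Δ : Type u} {Q : Type v} {M : OneLA α Δ Q} {w : List α}

theorem IsComputation.reflTransGen {c : ℕ → Config α Δ Q} {t : ℕ} (h : M.IsComputation w c t) :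
    ReflTransGen (M.Step w.length) (M.init w) (c t) := by
  have key : ∀ s ≤ t, ReflTransGen (M.Step w.length) (M.init w) (c s) := by
    intro s
    induction s with
    | zero => intro _; rw [h.1]
    | succ s ih => exact fun hs => (ih (by omega)).tail (h.2 s (by exact_mod_cast hs))
  exact key t le_rfl

theorem IsComputation.extend {c : ℕ → Config α Δ Q} {t : ℕ} (h : M.IsComputation w c t)
    {b : Config α Δ Q} (hb : M.Step w.length (c t) b) :
    M.IsComputation w (fun s => if s ≤ t then c s else b) (t + 1 : ℕ) := by
  refine ⟨by simpa using h.1, fun s hs => ?_⟩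
  have hs : s < t + 1 := by exact_mod_cast hs
  rcases Nat.lt_succ_iff_lt_or_eq.1 hs with hs | rfl
  · simpa [hs.le, Nat.succ_le_of_lt hs] using h.2 s (by exact_mod_cast hs)
  · simpa using hb

theorem exists_isComputation {c : Config α Δ Q}
    (h : ReflTransGen (M.Step w.length) (M.init w) c) :
    ∃ (s : ℕ → Config α Δ Q) (t : ℕ), M.IsComputation w s t ∧ s t = c := by
  induction h with
  | refl => exact ⟨fun _ => M.init w, 0, ⟨rfl, fun t ht => absurd ht (by simp)⟩, rfl⟩
  | tail _ hb ih =>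
    obtain ⟨s, t, hs, rfl⟩ := ih
    exact ⟨_, t + 1, hs.extend hb, by simp⟩

theorem mem_accepts_iff : w ∈ M.accepts ↔
    ∃ c, ReflTransGen (M.Step w.length) (M.init w) c ∧ c.head = w.length + 2 ∧
      c.state ∈ M.final := by
  constructor
  · rintro ⟨c, t, h, h1, h2⟩
    exact ⟨c t, h.reflTransGen, h1, h2⟩
  · rintro ⟨c, h, h1, h2⟩
    obtain ⟨s, t, hs, rfl⟩ := exists_isComputation h
    exact ⟨s, t, hs, h1, h2⟩

open Classical in
/-- The move made in state `q` on `y`, for a deterministic machine. -/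
noncomputable def move (M : OneLA α Δ Q) (q : Q) (y : TapeSym (α ⊕ Δ)) :
    Option (Q × TapeSym (α ⊕ Δ) × Dir) :=
  if h : (M.δ q y).Nonempty then some h.some else none

theorem mem_δ_iff (hM : M.Deterministic) {q : Q} {y : TapeSym (α ⊕ Δ)}
    {t : Q × TapeSym (α ⊕ Δ) × Dir} : t ∈ M.δ q y ↔ M.move q y = some t := by
  unfold move
  split_ifs with h
  · rw [Option.some.injEq]
    exact ⟨fun ht => hM q y h.some_mem ht, fun e => e ▸ h.some_mem⟩
  · simp only [iff_false]
    exact fun ht => h ⟨t, ht⟩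

end Runs

/-- The states of the two-way automaton simulating a machine that marks at most one cell:
* `unmarked q`: the machine is in state `q`, and no cell has been marked;
* `marked q p`: the machine is in state `p`, and a cell was marked in state `q`;
* `search p r k`: while the machine is in state `p`, backward search from state `r`, with the
  predecessors from number `k` on still to be tried;
* `probe p r k`: the same, with the head on the cell of the predecessor with number `k`;
* `rerun p r`: while the machine is in state `p`, its initial part is simulated again, and has
  reached the state `r`. -/
inductive SimState (Q : Type v) (m : ℕ) : Type v
  | unmarked (q : Q)
  | marked (q p : Q)
  | search (p r : Q) (k : Fin (m + 1))
  | probe (p r : Q) (k : Fin m)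
  | rerun (p r : Q)

namespace SimState

variable {Q : Type v} {m : ℕ}

/-- The states as elements of a sum type. -/
def toSum : SimState Q m → Q ⊕ (Q × Q) ⊕ (Q × Q × Fin (m + 1)) ⊕ (Q × Q × Fin m) ⊕ (Q × Q)
  | unmarked q => .inl q
  | marked q p => .inr (.inl (q, p))
  | search p r k => .inr (.inr (.inl (p, r, k)))
  | probe p r k => .inr (.inr (.inr (.inl (p, r, k))))
  | rerun p r => .inr (.inr (.inr (.inr (p, r))))

theorem toSum_injective : Function.Injective (toSum (Q := Q) (m := m)) := by
  intro a b h
  cases a <;> cases b <;> simp_all [toSum]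

instance [Finite Q] : Finite (SimState Q m) := Finite.of_injective _ toSum_injective

theorem card_le [Finite Q] :
    Nat.card (SimState Q m) ≤
      Nat.card Q + Nat.card Q ^ 2 * (m + 1 + m + 2) := by
  refine (Nat.card_le_card_of_injective _ toSum_injective).trans (le_of_eq ?_)
  simp only [Nat.card_sum, Nat.card_prod, Nat.card_fin]
  ring

end SimState

/-! ### Simulating a machine that marks at most one cell. -/

section Simulation

variable {α : Type u} {Q : Type v} (M : OneLA α α Q) {m : ℕ} (e : Q × Dir ≃ Fin m)

/-- The marked version of a tape symbol. -/
def markSym : TapeSym α → TapeSym (α ⊕ α) := TapeSym.map Sum.inr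

/-- The unmarked version of a tape symbol. -/
def plainSym : TapeSym α → TapeSym (α ⊕ α) := TapeSym.map Sum.inl

open Classical in
/-- The part of the machine that modifies no cell. -/
noncomputable def silent : TwoDFA α Q where
  δ q y := (M.move q (plainSym y)).bind fun t =>
    if t.2.1 = plainSym y then some (t.1, t.2.2) else none
  start := M.start
  final := ∅

theorem silent_δ {q p : Q} {y : TapeSym α} {d : Dir} :
    M.silent.δ q y = some (p, d) ↔ M.move q (plainSym y) = some (p, plainSym y, d) := by
  simp only [silent, Option.bind_eq_some_iff, Option.ite_none_right_eq_some, Option.some.injEq,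
    Prod.mk.injEq]
  constructor
  · rintro ⟨⟨p', x, d'⟩, h, rfl, rfl, rfl⟩
    exact h
  · exact fun h => ⟨_, h, rfl, rfl, rfl⟩

/-- A cell containing `y` is modified in state `q`. -/
def Writes (q : Q) (y : TapeSym α) : Prop :=
  ∃ p x d, M.move q (plainSym y) = some (p, x, d) ∧ x ≠ plainSym y

theorem Writes.silent_δ {M : OneLA α α Q} {q : Q} {y : TapeSym α} (h : M.Writes q y) :
    M.silent.δ q y = none := by
  obtain ⟨p, x, d, h, hx⟩ := h
  simp [silent, h, hx]

theorem Writes.not_step {M : OneLA α α Q} {w : List α} {q : Q} {i : ℕ}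
    (h : M.Writes q (tapeOf w i)) (c : Q × ℕ) : ¬ M.silent.Step w (q, i) c := by
  rintro ⟨_, d, hd, _⟩
  simp [h.silent_δ] at hd

open Classical in
/-- The transition function of the simulating automaton. -/
noncomputable def simDelta : SimState Q m → TapeSym α → Option (SimState Q m × Option Dir)
  | .unmarked r, y => (M.move r (plainSym y)).map fun t =>
      (if t.2.1 = plainSym y then .unmarked t.1 else .marked r t.1, some t.2.2)
  | .marked q p, y =>
      if M.Writes q y then some (.search p q 0, none)
      else (M.move p (plainSym y)).map fun t => (.marked q t.1, some t.2.2)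
  | .search p r k, y =>
      Fin.lastCases (motive := fun _ => Option (SimState Q m × Option Dir))
        -- All predecessors are exhausted. Either `silent` moves on to the parent, where the search
        -- resumes after the number of the present node, or there is no move: this is the root, `r`
        -- is the marking state, and the cell is unmarked.
        (match M.silent.δ r y with
          | some (r', d) => some (.search p r' (e (r, d)).succ, some d)
          | none => (M.move p (plainSym y)).map fun t => (.marked r t.1, some t.2.2))
        (fun k =>
          if (e.symm k).2.Blocked y then some (.search p r k.succ, none)
          else some (.probe p r k, some (e.symm k).2.opp)) k
  | .probe p r k, y =>
      -- The node under examination has state `r` and lies one cell to the right of the left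
      -- end-marker, so it is the initial configuration.
      if (e.symm k).2 = .fwd ∧ y = .left ∧ r = M.start then some (.rerun p M.start, some .fwd)
      else if M.silent.δ (e.symm k).1 y = some (r, (e.symm k).2) then
        some (.search p (e.symm k).1 0, none)
      else some (.search p r k.succ, some (e.symm k).2)
  | .rerun p r, y =>
      match M.silent.δ r y with
      | some (r', d) => some (.rerun p r', some d)
      -- The rerun gets stuck at the marked cell, in the marking state.
      | none => (M.move p (markSym y)).map fun t => (.marked r t.1, some t.2.2)

/-- The automaton simulating a machine that marks at most one cell. After the marking, whenever
the state in which a cell was marked would modify the scanned cell, it is found out by a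
depth-first search among the predecessors of that configuration whether it is reached from the
initial configuration, that is, whether the scanned cell is the marked one. -/
noncomputable def simulator : StayDFA α (SimState Q m) where
  δ := M.simDelta e
  start := .unmarked M.start
  final := {s | match s with
    | .unmarked q => q ∈ M.final
    | .marked _ p => p ∈ M.final
    | _ => False}

variable {M}

/-- This is the loop over the predecessors of one node, by downward induction on the number `k`; the
subtrees are covered by `ih`. The failing alternative records only what the numbers from `k` on rule
out, so that unreachability of the node follows at `k = 0`. -/
theorem search_outcome_from {w : List α} (p : Q) {r : Q} {i : ℕ} (hi : i ≤ w.length + 1)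
    (ih : ∀ u, M.silent.Step w u (r, i) →
      ReflTransGen (M.silent.Step w) (M.start, 1) u ∧
          ReflTransGen ((M.simulator e).Step w) (.search p u.1 0, u.2) (.rerun p M.start, 1) ∨
        ¬ ReflTransGen (M.silent.Step w) (M.start, 1) u ∧
          ReflTransGen ((M.simulator e).Step w) (.search p u.1 0, u.2)
            (.search p u.1 (Fin.last m), u.2)) (k : Fin (m + 1)) :
    ReflTransGen (M.silent.Step w) (M.start, 1) (r, i) ∧
        ReflTransGen ((M.simulator e).Step w) (.search p r k, i) (.rerun p M.start, 1) ∨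
      (∀ k' : Fin m, k ≤ k'.castSucc → ((e.symm k').2 = .fwd → (r, i) ≠ (M.start, 1)) ∧
          ∀ j ≤ w.length + 1, M.silent.δ (e.symm k').1 (tapeOf w j) = some (r, (e.symm k').2) →
            (e.symm k').2.move j = some i →
              ¬ ReflTransGen (M.silent.Step w) (M.start, 1) ((e.symm k').1, j)) ∧
        ReflTransGen ((M.simulator e).Step w) (.search p r k, i)
          (.search p r (Fin.last m), i) := by
  induction k using Fin.reverseInduction with
  | last =>
    refine .inr ⟨fun k' hk => ?_, .refl⟩
    exact absurd (Fin.castSucc_lt_last k') (not_lt.2 hk)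
  | cast k ihk =>
    obtain ⟨⟨s, d⟩, hsd⟩ : ∃ c, e.symm k = c := ⟨_, rfl⟩
    have hek : e (s, d) = k := by rw [← hsd, e.apply_symm_apply]
    -- Either the initial configuration is found through this predecessor, or the next is tried.
    suffices hs : ReflTransGen (M.silent.Step w) (M.start, 1) (r, i) ∧
          ReflTransGen ((M.simulator e).Step w) (.search p r k.castSucc, i)
            (.rerun p M.start, 1) ∨
        ReflTransGen ((M.simulator e).Step w) (.search p r k.castSucc, i)
            (.search p r k.succ, i) ∧
          (d = .fwd → (r, i) ≠ (M.start, 1)) ∧ ∀ j ≤ w.length + 1,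
            M.silent.δ s (tapeOf w j) = some (r, d) → d.move j = some i →
              ¬ ReflTransGen (M.silent.Step w) (M.start, 1) (s, j) by
      rcases hs with h | ⟨h, h1, h2⟩
      · exact .inl h
      rcases ihk with ⟨h3, h4⟩ | ⟨h3, h4⟩
      · exact .inl ⟨h3, h.trans h4⟩
      · refine .inr ⟨fun k' hk => ?_, h.trans h4⟩
        rcases hk.lt_or_eq with hk | hk
        · exact h3 k' (Fin.succ_le_castSucc_iff.2 (Fin.castSucc_lt_castSucc_iff.1 hk))
        · obtain rfl := Fin.castSucc_injective _ hk
          rw [hsd]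
          exact ⟨h1, h2⟩
    by_cases hb : d.Blocked (tapeOf w i)
    · refine .inr ⟨.single ⟨hi, none, ?_, rfl⟩, ?_, ?_⟩
      · simp [simulator, simDelta, hsd, hb]
      · rintro rfl h
        rw [Dir.Blocked, tapeOf_eq_left] at hb
        simp_all
      · exact fun j hj _ hm _ => Dir.not_blocked hj hm hb
    · obtain ⟨j, hj, hij, hji⟩ := Dir.exists_of_not_blocked hi hb
      have probe : ReflTransGen ((M.simulator e).Step w) (.search p r k.castSucc, i)
          (.probe p r k, j) :=
        .single ⟨hi, some d.opp, by simp [simulator, simDelta, hsd, hb], hij⟩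
      by_cases hstart : d = .fwd ∧ tapeOf w j = .left ∧ r = M.start
      · refine .inl ?_
        obtain ⟨rfl, hj0, rfl⟩ := hstart
        have hj0' := tapeOf_eq_left.1 hj0
        subst hj0'
        simp only [Dir.move, zero_add, Option.some.injEq] at hji
        subst hji
        refine ⟨.refl, probe.tail ⟨hj, some .fwd, ?_, rfl⟩⟩
        simp [simulator, simDelta, hsd, hj0]
      have hne : d = .fwd → (r, i) ≠ (M.start, 1) := by
        rintro rfl h
        simp only [Prod.mk.injEq] at h
        obtain ⟨rfl, rfl⟩ := h
        simp only [Dir.move, Option.some.injEq] at hji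
        exact hstart ⟨rfl, tapeOf_eq_left.2 (by omega), rfl⟩
      by_cases hpred : M.silent.δ s (tapeOf w j) = some (r, d)
      · have hstep : M.silent.Step w (s, j) (r, i) := ⟨hj, d, hpred, hji⟩
        have down : ReflTransGen ((M.simulator e).Step w) (.search p r k.castSucc, i)
            (.search p s 0, j) :=
          probe.tail ⟨hj, none, by simp [simulator, simDelta, hsd, hstart, hpred], rfl⟩
        rcases ih _ hstep with ⟨h1, h2⟩ | ⟨h1, h2⟩
        · exact .inl ⟨h1.tail hstep, down.trans h2⟩
        -- The failed search of the subtree ends at its root `(s, j)`, whose forward move returns to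
        -- `(r, i)` with the next number.
        · refine .inr ⟨(down.trans h2).tail ⟨hj, some d, ?_, hji⟩, hne, ?_⟩
          · simp [simulator, simDelta, hpred, hek]
          · intro j' _ _ hm
            rwa [Dir.move_injective hm hji]
      · refine .inr ⟨probe.tail ⟨hj, some d, ?_, hji⟩, hne, ?_⟩
        · simp [simulator, simDelta, hsd, hstart, hpred]
        · intro j' _ h hm
          rw [Dir.move_injective hm hji] at h
          exact absurd h hpred

/-- The backward search finds out whether a configuration is reached from the initial one. -/
theorem search_outcome {w : List α} (p : Q) {c : Q × ℕ} (hc : Acc (M.silent.Step w) c)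
    (hi : c.2 ≤ w.length + 1) :
    ReflTransGen (M.silent.Step w) (M.start, 1) c ∧
        ReflTransGen ((M.simulator e).Step w) (.search p c.1 0, c.2) (.rerun p M.start, 1) ∨
      ¬ ReflTransGen (M.silent.Step w) (M.start, 1) c ∧
        ReflTransGen ((M.simulator e).Step w) (.search p c.1 0, c.2)
          (.search p c.1 (Fin.last m), c.2) := by
  induction hc with
  | intro c _ ih =>
    obtain ⟨r, i⟩ := c
    rcases search_outcome_from e p hi (fun u hu => ih u hu hu.1) 0 with h | ⟨h, h'⟩
    · exact .inl h
    · refine .inr ⟨fun hr => ?_, h'⟩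
      rcases hr.cases_tail with heq | ⟨⟨s, j⟩, hs, hj, d, hd, hm⟩
      -- The test for the initial configuration accompanies every forward predecessor, so any state
      -- could replace `M.start` here.
      · refine (h (e (M.start, .fwd)) (Fin.zero_le _)).1 (by simp) heq
      · have := (h (e (s, d)) (Fin.zero_le _)).2 j hj
        simp only [Equiv.symm_apply_apply] at this
        exact this hd hm hs

theorem rerun_reaches {w : List α} (p : Q) {c : Q × ℕ}
    (h : ReflTransGen (M.silent.Step w) (M.start, 1) c) :
    ReflTransGen ((M.simulator e).Step w) (.rerun p M.start, 1) (.rerun p c.1, c.2) := by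
  refine ReflTransGen.lift (fun c : Q × ℕ => (SimState.rerun p c.1, c.2)) ?_ _ _ h
  rintro ⟨a, i⟩ ⟨b, j⟩ ⟨hi, d, hd, hm⟩
  simp only at hd
  exact ⟨hi, some d, by simp [simulator, simDelta, hd], hm⟩

/-- The tape contents after cell `j` of the input `w` has been marked. -/
def markedTape (w : List α) (j : ℕ) : ℕ → TapeSym (α ⊕ α) :=
  Function.update (fun i => plainSym (tapeOf w i)) j (markSym (tapeOf w j))

theorem markedTape_self (w : List α) (j : ℕ) : markedTape w j j = markSym (tapeOf w j) :=
  Function.update_self ..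

theorem markedTape_of_ne (w : List α) {i j : ℕ} (h : i ≠ j) :
    markedTape w j i = plainSym (tapeOf w i) :=
  Function.update_of_ne h ..

/-- After a cell has been marked, the simulating automaton finds the move to be made. -/
theorem marked_outcome [Finite Q] {w : List α} (p : Q) {q : Q} {i j : ℕ} (hi : i ≤ w.length + 1)
    (hw : M.Writes q (tapeOf w j))
    (hj : ReflTransGen (M.silent.Step w) (M.start, 1) (q, j)) :
    ∃ s, ReflTransGen ((M.simulator e).Step w) (.marked q p, i) (s, i) ∧
      (M.simulator e).δ s (tapeOf w i) =
        (M.move p (markedTape w j i)).map fun t => (.marked q t.1, some t.2.2) := by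
  by_cases hwi : M.Writes q (tapeOf w i)
  · have first : (M.simulator e).Step w (.marked q p, i) (.search p q 0, i) :=
      ⟨hi, none, by simp [simulator, simDelta, hwi], rfl⟩
    rcases search_outcome e p (M.silent.acc_of_halting hwi.not_step hi) hi with
      ⟨h1, h2⟩ | ⟨h1, h2⟩
    -- Both `(q, i)` and `(q, j)` are halting and reachable, hence the scanned cell is the marked
    -- one.
    · have heq := halting_unique (M.silent.step_rightUnique w) h1 hj hwi.not_step hw.not_step
      simp only [Prod.mk.injEq, true_and] at heq
      subst heq
      refine ⟨.rerun p q, (h2.head first).trans (rerun_reaches e p h1), ?_⟩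
      simp [simulator, simDelta, hwi.silent_δ, markedTape_self]
    · refine ⟨_, h2.head first, ?_⟩
      rw [markedTape_of_ne w (by rintro rfl; exact h1 hj)]
      simp [simulator, simDelta, hwi.silent_δ]
  · refine ⟨_, .refl, ?_⟩
    rw [markedTape_of_ne w (by rintro rfl; exact hwi hw)]
    simp [simulator, simDelta, hwi]

/-- The configurations of the simulating automaton that correspond to those of the machine. -/
inductive Corresponds (M : OneLA α α Q) (w : List α) (c : Config α α Q) :
    SimState Q m × ℕ → Prop
  | unmarked {s : ℕ → Config α α Q} {t : ℕ} (hs : M.IsComputation w s t) (hc : s t = c)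
      (htape : c.tape = fun i => plainSym (tapeOf w i))
      (hr : ReflTransGen (M.silent.Step w) (M.start, 1) (c.state, c.head)) :
      Corresponds M w c (.unmarked c.state, c.head)
  | marked {s : ℕ → Config α α Q} {t : ℕ} (hs : M.IsComputation w s t) (hc : s t = c)
      {q : Q} {j : ℕ} (hw : M.Writes q (tapeOf w j))
      (hj : ReflTransGen (M.silent.Step w) (M.start, 1) (q, j)) {a : α}
      (ha : tapeOf w j = .sym a) (htape : c.tape = markedTape w j)
      (hvisit : ∃ u < t, (s u).head = j) :
      Corresponds M w c (.marked q c.state, c.head)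

/-! ### Correctness of the simulation. -/

theorem init_tape (w : List α) : (M.init w).tape = fun i => plainSym (tapeOf w i) :=
  funext fun i => tapeOf_map Sum.inl w i

/-- The simulator reaches a state whose move is the image under `g` of the machine's move.
Expressing this as an equality of partial moves serves both the simulation of a step and the
preservation of halting. -/
theorem Corresponds.outcome [Finite Q] (hlim : M.OneLimited) (hdet : M.Deterministic)
    (hmark : M.MarksAtMostOneCell) {w : List α} {c : Config α α Q} {b : SimState Q m × ℕ}
    (hcb : M.Corresponds w c b) (hi : c.head ≤ w.length + 1) :
    ∃ s, ∃ g : Q → TapeSym (α ⊕ α) → SimState Q m,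
      ReflTransGen ((M.simulator e).Step w) b (s, c.head) ∧
      (M.simulator e).δ s (tapeOf w c.head) =
        (M.move c.state (c.tape c.head)).map (fun t => (g t.1 t.2.1, some t.2.2)) ∧
      ∀ c' x d, M.move c.state (c.tape c.head) = some (c'.state, x, d) →
        d.move c.head = some c'.head → c'.tape = Function.update c.tape c.head x →
          M.Corresponds w c' (g c'.state x, c'.head) := by
  classical
  cases hcb with
  | @unmarked s t hs hc htape hr =>
    refine ⟨.unmarked c.state, fun p x =>
      if x = plainSym (tapeOf w c.head) then .unmarked p else .marked c.state p, .refl, ?_, ?_⟩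
    · simp only [simulator, simDelta, htape]
    · intro c' x d hx hd htape'
      have hs' := hs.extend (b := c') (by
        rw [hc]
        exact ⟨hi, x, d, (mem_δ_iff hdet).2 hx, hd, htape'⟩)
      rw [htape] at hx
      beta_reduce at hx ⊢
      split_ifs with hx'
      · subst hx'
        refine .unmarked hs' (by simp) ?_ (hr.tail ⟨hi, d, M.silent_δ.2 hx, hd⟩)
        rw [htape', htape]
        exact Function.update_eq_self _ _
      -- The first modification can only turn an input letter into its marked version.
      · obtain ⟨j, hj⟩ := hmark w _ _ hs'
        have := hj (t + 1) le_rfl c.head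
        simp only [zero_le, if_true, hs.1, init_tape] at this
        simp only [Nat.not_succ_le_self, if_false, htape', Function.update_self, hx',
          false_or] at this
        obtain ⟨rfl, a, h1, rfl⟩ := this
        have ha : tapeOf w c.head = .sym a := by
          cases h : tapeOf w c.head <;> simp_all [plainSym, TapeSym.map]
        refine .marked hs' (by simp) ⟨_, _, _, hx, hx'⟩ hr ha ?_ ⟨t, by omega, by simp [hc]⟩
        rw [htape', htape, markedTape, ha]
        rfl
  | @marked s t hs hc q j hw hj a ha htape hvisit =>
    obtain ⟨z, hz, hδ⟩ := marked_outcome e c.state hi hw hj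
    refine ⟨z, fun p _ => .marked q p, hz, by rw [hδ, htape], ?_⟩
    intro c' x d hx hd htape'
    have hs' := hs.extend (b := c') (by
      rw [hc]
      exact ⟨hi, x, d, (mem_δ_iff hdet).2 hx, hd, htape'⟩)
    -- No second write is possible: the marked cell has been visited before, which excludes it by
    -- one-limitedness, and any other cell would be a second changed one.
    have hx' : x = c.tape c.head := by
      by_contra hne
      by_cases hij : c.head = j
      · obtain ⟨u, hu, huj⟩ := hvisit
        refine hlim w _ _ hs' t (by exact_mod_cast Nat.lt_succ_self t) ?_ u hu ?_
        · simpa [hc, htape'] using hne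
        · simpa [hu.le, hc, hij] using huj
      · obtain ⟨j', hj'⟩ := hmark w _ _ hs'
        have h1 := hj' (t + 1) le_rfl c.head
        have h2 := hj' (t + 1) le_rfl j
        simp only [zero_le, if_true, hs.1, init_tape, Nat.not_succ_le_self, if_false, htape']
          at h1 h2
        rw [Function.update_self] at h1
        rw [Function.update_of_ne (Ne.symm hij), htape, markedTape_self, ha] at h2
        rw [htape, markedTape_of_ne w hij] at hne
        have hne' : markSym (.sym a) ≠ plainSym (.sym a) := by simp [markSym, plainSym, TapeSym.map]
        exact hij ((h1.resolve_left hne).1.trans (h2.resolve_left hne').1.symm)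
    obtain ⟨u, hu, huj⟩ := hvisit
    refine .marked hs' (by simp) hw hj ha ?_ ⟨u, by omega, by simpa [hu.le] using huj⟩
    rw [htape', hx', Function.update_eq_self, htape]

theorem Corresponds.step [Finite Q] (hlim : M.OneLimited) (hdet : M.Deterministic)
    (hmark : M.MarksAtMostOneCell) {w : List α} {c c' : Config α α Q} {b : SimState Q m × ℕ}
    (hcb : M.Corresponds w c b) (hc : M.Step w.length c c') :
    ∃ b', M.Corresponds w c' b' ∧ TransGen ((M.simulator e).Step w) b b' := by
  obtain ⟨hi, x, d, hx, hd, htape⟩ := hc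
  obtain ⟨s, g, hbs, hδ, h⟩ := hcb.outcome e hlim hdet hmark hi
  rw [mem_δ_iff hdet] at hx
  refine ⟨_, h c' x d hx hd htape, TransGen.tail' hbs ⟨hi, some d, ?_, hd⟩⟩
  simp [hδ, hx]

/-- Needed for soundness: where the machine is stuck, the simulator must not go on to accept. -/
theorem Corresponds.halt [Finite Q] (hlim : M.OneLimited) (hdet : M.Deterministic)
    (hmark : M.MarksAtMostOneCell) {w : List α} {c : Config α α Q} {b : SimState Q m × ℕ}
    (hcb : M.Corresponds w c b) (hi : c.head ≤ w.length + 1)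
    (hc : ∀ c', ¬ M.Step w.length c c') :
    ∃ s, ReflTransGen ((M.simulator e).Step w) b (s, c.head) ∧
      ∀ b', ¬ (M.simulator e).Step w (s, c.head) b' := by
  obtain ⟨s, g, hbs, hδ, h⟩ := hcb.outcome e hlim hdet hmark hi
  refine ⟨s, hbs, ?_⟩
  rintro ⟨s', i'⟩ ⟨_, d, hd, hm⟩
  simp only [hδ, Option.map_eq_some_iff, Prod.mk.injEq] at hd
  obtain ⟨⟨p, x, d'⟩, hp, -, rfl⟩ := hd
  exact hc ⟨p, i', Function.update c.tape c.head x⟩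
    ⟨hi, x, d', (mem_δ_iff hdet).2 hp, hm, rfl⟩

theorem Corresponds.final_iff {w : List α} {c : Config α α Q} {b : SimState Q m × ℕ}
    (hcb : M.Corresponds w c b) :
    b.2 = c.head ∧ (b.1 ∈ (M.simulator e).final ↔ c.state ∈ M.final) := by
  cases hcb <;> exact ⟨rfl, .rfl⟩

theorem accepts_simulator [Finite Q] (hlim : M.OneLimited) (hdet : M.Deterministic)
    (hmark : M.MarksAtMostOneCell) : (M.simulator e).accepts = M.accepts := by
  ext w
  have hr := (M.simulator e).step_rightUnique w
  have hinit : M.Corresponds w (M.init w) (SimState.unmarked (m := m) M.start, 1) :=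
    .unmarked (s := fun _ => M.init w) (t := 0) ⟨rfl, fun t ht => absurd ht (by simp)⟩ rfl
      (init_tape w) .refl
  rw [mem_accepts_iff]
  constructor
  · rintro ⟨f, hf, h⟩
    -- Induction follows the accepting run of the simulator, while `b₁` is the next configuration on
    -- it that corresponds to one of the machine; intermediate search steps merely bring `b` closer
    -- to `b₁`.
    have key : ∀ b, ReflTransGen ((M.simulator e).Step w) b (f, w.length + 2) →
        ∀ c b₁, M.Corresponds w c b₁ → ReflTransGen ((M.simulator e).Step w) b b₁ →
          ∃ c', ReflTransGen (M.Step w.length) c c' ∧ c'.head = w.length + 2 ∧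
            c'.state ∈ M.final := by
      intro b hb
      induction hb using ReflTransGen.head_induction_on with
      | refl =>
        intro c b₁ hcb hb₁
        rcases hb₁.cases_head with rfl | ⟨d, hd, _⟩
        · exact ⟨c, .refl, (hcb.final_iff e).1.symm, (hcb.final_iff e).2.1 hf⟩
        · exact absurd hd ((M.simulator e).not_step_of_passed w f d)
      | @head b b' hbb' hb' ih =>
        intro c b₁ hcb hb₁
        rcases hb₁.cases_head with rfl | ⟨d, hd, hd'⟩
        · have hi : c.head ≤ w.length + 1 := (hcb.final_iff e).1 ▸ hbb'.1
          by_cases hc : ∃ c', M.Step w.length c c'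
          · obtain ⟨c', hc⟩ := hc
            obtain ⟨b₂, hcb₂, hb₂⟩ := hcb.step e hlim hdet hmark hc
            obtain ⟨d, hd, hd'⟩ := TransGen.head'_iff.1 hb₂
            obtain rfl := hr hd hbb'
            obtain ⟨c'', h1, h2⟩ := ih c' b₂ hcb₂ hd'
            exact ⟨c'', h1.head hc, h2⟩
          · obtain ⟨s, hs, hs'⟩ := hcb.halt e hlim hdet hmark hi (not_exists.1 hc)
            have := halting_unique hr hs (hb'.head hbb') hs'
              ((M.simulator e).not_step_of_passed w f)
            simp only [Prod.mk.injEq] at this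
            omega
        · obtain rfl := hr hd hbb'
          exact ih c b₁ hcb hd'
    exact key _ h _ _ hinit .refl
  · rintro ⟨c', h, hhead, hfin⟩
    have key : ∀ c, ReflTransGen (M.Step w.length) (M.init w) c → ∃ b, M.Corresponds w c b ∧
        ReflTransGen ((M.simulator e).Step w) (.unmarked M.start, 1) b := by
      intro c hc
      induction hc with
      | refl => exact ⟨_, hinit, .refl⟩
      | tail _ hc ih =>
        obtain ⟨b, hcb, hb⟩ := ih
        obtain ⟨b', hcb', hb'⟩ := hcb.step e hlim hdet hmark hc
        exact ⟨b', hcb', hb.trans hb'.to_reflTransGen⟩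
    obtain ⟨⟨s, i⟩, hcb, hb⟩ := key _ h
    obtain ⟨h1, h2⟩ := hcb.final_iff e
    simp only [hhead] at h1
    subst h1
    exact ⟨s, h2.2 hfin, hb⟩

end Simulation

theorem exists_twoDFA {α : Type u} {Q : Type v} [Finite Q] (M : OneLA α α Q)
    (hlim : M.OneLimited) (hdet : M.Deterministic) (hmark : M.MarksAtMostOneCell) :
    ∃ (m : ℕ) (B : TwoDFA α (Fin m)), m ≤ 10 * Nat.card Q ^ 3 ∧ B.accepts = M.accepts := by
  let e := Finite.equivFin (Q × Dir)
  refine ⟨_, (M.simulator e).toTwoDFA.reindex (Finite.equivFin _), ?_, ?_⟩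
  · refine SimState.card_le.trans ?_
    rw [Nat.card_prod, card_dir]
    have : Nonempty Q := ⟨M.start⟩
    have hn : 1 ≤ Nat.card Q := Nat.card_pos
    generalize Nat.card Q = n at *
    -- With `m = 2n` the count is `n + n²(4n + 3) ≤ 8n³`, so the constant 10 leaves room.
    have h2 : n ≤ n ^ 2 := Nat.le_self_pow (by norm_num) n
    have h3 : n ^ 2 ≤ n ^ 3 := Nat.pow_le_pow_right hn (by norm_num)
    ring_nf
    omega
  · rw [TwoDFA.accepts_reindex, StayDFA.accepts_toTwoDFA, accepts_simulator e hlim hdet hmark]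

/-! ### From a two-way automaton to a once-marking machine. -/

section FirstMark

variable {α : Type u} {Q : Type v}

/-- The symbol without its mark. -/
def eraseSym : TapeSym (α ⊕ α) → TapeSym α := TapeSym.map (Sum.elim id id)

/-- The first move of `B` on a cell containing `y`; if there is none, a move to the right into a
dead state. -/
def firstMove (B : TwoDFA α Q) (y : TapeSym α) : Option Q × Dir :=
  (B.δ B.start y).elim (none, .fwd) fun t => (some t.1, t.2)

/-- The two-way automaton `B` as a machine whose first move marks the first cell. The states are
a fresh initial state, a dead state, and the states of `B`. They are renamed by `e`. -/
def markFirst {S : Type*} (B : TwoDFA α Q) (e : S ≃ Option (Option Q)) : OneLA α α S where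
  δ s y := {t | match e s with
    | none => t = (e.symm (some (firstMove B (eraseSym y)).1), markSym (eraseSym y),
        (firstMove B (eraseSym y)).2)
    | some none => False
    | some (some q) => ∃ p d, B.δ q (eraseSym y) = some (p, d) ∧
        t = (e.symm (some (some p)), y, d)}
  start := e.symm none
  final := {s | ∃ q ∈ B.final, s = e.symm (some (some q))}
  write_left q p x d h := by
    simp only [Set.mem_ofPred_eq] at h
    split at h
    · cases h; rfl
    · exact h.elim
    · obtain ⟨_, _, _, h⟩ := h
      cases h; rfl
  write_right q p x d h := by
    simp only [Set.mem_ofPred_eq] at h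
    split at h
    · cases h; rfl
    · exact h.elim
    · obtain ⟨_, _, _, h⟩ := h
      cases h; rfl
  write_sym q b p x d h := by
    simp only [Set.mem_ofPred_eq] at h
    split at h
    · cases h; exact ⟨_, rfl⟩
    · exact h.elim
    · obtain ⟨_, _, _, h⟩ := h
      cases h; exact ⟨_, rfl⟩

variable {S : Type*} {B : TwoDFA α Q} {e : S ≃ Option (Option Q)}

theorem mem_markFirst_δ_none {y : TapeSym (α ⊕ α)} {t : S × TapeSym (α ⊕ α) × Dir} :
    t ∈ (markFirst B e).δ (e.symm none) y ↔
      t = (e.symm (some (firstMove B (eraseSym y)).1), markSym (eraseSym y),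
        (firstMove B (eraseSym y)).2) := by
  simp [markFirst]

theorem mem_markFirst_δ_dead {y : TapeSym (α ⊕ α)} {t : S × TapeSym (α ⊕ α) × Dir} :
    t ∉ (markFirst B e).δ (e.symm (some none)) y := by
  simp [markFirst]

theorem mem_markFirst_δ_some {q : Q} {y : TapeSym (α ⊕ α)} {t : S × TapeSym (α ⊕ α) × Dir} :
    t ∈ (markFirst B e).δ (e.symm (some (some q))) y ↔
      ∃ p d, B.δ q (eraseSym y) = some (p, d) ∧ t = (e.symm (some (some p)), y, d) := by
  simp [markFirst]

theorem markFirst_deterministic : (markFirst B e).Deterministic := by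
  intro s y t h t' h'
  obtain ⟨s, rfl⟩ := e.symm.surjective s
  rcases s with _ | _ | q
  · rw [mem_markFirst_δ_none] at h h'
    rw [h, h']
  · exact absurd h mem_markFirst_δ_dead
  · rw [mem_markFirst_δ_some] at h h'
    obtain ⟨p, d, hp, rfl⟩ := h
    obtain ⟨p', d', hp', rfl⟩ := h'
    rw [hp] at hp'
    cases hp'
    rfl

theorem eraseSym_markSym (y : TapeSym α) : eraseSym (markSym y) = y := by
  cases y <;> rfl

theorem eraseSym_plainSym (y : TapeSym α) : eraseSym (plainSym y) = y := by
  cases y <;> rfl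

/-- The first move marks the first cell. -/
theorem markFirst_step_start {w : List α} {c : Config α α S}
    (h : (markFirst B e).Step w.length ((markFirst B e).init w) c) :
    c.tape = markedTape w 1 ∧ (c.state = e.symm (some none) ∨
      ∃ p, c.state = e.symm (some (some p)) ∧ B.Step w (B.start, 1) (p, c.head)) := by
  obtain ⟨hi, x, d, hx, hd, htape⟩ := h
  rw [init_tape] at hx htape
  have hx := mem_markFirst_δ_none.1 hx
  simp only [init, eraseSym_plainSym, Prod.mk.injEq] at hi hd hx htape
  obtain ⟨hs, rfl, rfl⟩ := hx
  refine ⟨htape, ?_⟩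
  rcases hB : B.δ B.start (tapeOf w 1) with _ | ⟨p, d⟩
  · simp only [firstMove, hB, Option.elim] at hs
    exact .inl hs
  · simp only [firstMove, hB, Option.elim] at hs hd
    exact .inr ⟨p, hs, hi, d, hB, hd⟩

/-- From cell 1 either direction is possible, and the dead state supplies a move where `B` has none.
So the mark is made even if `B` halts at once. -/
theorem markFirst_exists_step (w : List α) :
    ∃ c, (markFirst B e).Step w.length ((markFirst B e).init w) c := by
  obtain ⟨i, hi⟩ : ∃ i, (firstMove B (tapeOf w 1)).2.move 1 = some i := by
    cases (firstMove B (tapeOf w 1)).2 <;> exact ⟨_, rfl⟩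
  refine ⟨⟨e.symm (some (firstMove B (tapeOf w 1)).1), i, _⟩, by simp [init],
    markSym (tapeOf w 1), _, ?_, hi, rfl⟩
  rw [init_tape]
  refine mem_markFirst_δ_none.2 ?_
  simp [init, eraseSym_plainSym]

theorem markFirst_step {w : List α} {c c' : Config α α S}
    (h : (markFirst B e).Step w.length c c') (hc : c.state ≠ e.symm none) :
    c'.tape = c.tape ∧ ∃ q p, c.state = e.symm (some (some q)) ∧
      c'.state = e.symm (some (some p)) ∧
        ((∀ i, eraseSym (c.tape i) = tapeOf w i) → B.Step w (q, c.head) (p, c'.head)) := by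
  obtain ⟨hi, x, d, hx, hd, htape⟩ := h
  obtain ⟨s, hs⟩ := e.symm.surjective c.state
  rw [← hs] at hc hx
  rcases s with _ | _ | q
  · exact absurd rfl hc
  · exact absurd hx mem_markFirst_δ_dead
  · obtain ⟨p, d', hp, h⟩ := mem_markFirst_δ_some.1 hx
    simp only [Prod.mk.injEq] at h
    obtain ⟨h1, rfl, rfl⟩ := h
    refine ⟨by rw [htape, Function.update_eq_self], q, p, hs.symm, h1, fun ht => ?_⟩
    exact ⟨hi, d, by rw [← ht]; exact hp, hd⟩

theorem markFirst_step_of {w : List α} {c : Config α α S} {q : Q} {x : Q × ℕ}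
    (hc : c.state = e.symm (some (some q))) (ht : ∀ i, eraseSym (c.tape i) = tapeOf w i)
    (h : B.Step w (q, c.head) x) :
    (markFirst B e).Step w.length c ⟨e.symm (some (some x.1)), x.2, c.tape⟩ := by
  obtain ⟨hi, d, hd, hm⟩ := h
  refine ⟨hi, c.tape c.head, d, ?_, hm, (Function.update_eq_self _ _).symm⟩
  rw [hc]
  exact mem_markFirst_δ_some.2 ⟨x.1, d, by rw [ht]; exact hd, rfl⟩

theorem eraseSym_markedTape (w : List α) (j i : ℕ) :
    eraseSym (markedTape w j i) = tapeOf w i := by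
  by_cases h : i = j
  · rw [h, markedTape_self, eraseSym_markSym]
  · rw [markedTape_of_ne w h, eraseSym_plainSym]

theorem markFirst_computation {w : List α} {c : ℕ → Config α α S} {T : ℕ∞}
    (h : (markFirst B e).IsComputation w c T) (t : ℕ) (ht : ((t + 1 : ℕ) : ℕ∞) ≤ T) :
    (c (t + 1)).tape = markedTape w 1 ∧ (c (t + 1)).state ≠ e.symm none := by
  induction t with
  | zero =>
    have h0 := h.2 0 (lt_of_lt_of_le (by norm_num) ht)
    rw [h.1] at h0
    obtain ⟨h1, h2 | ⟨p, h2, -⟩⟩ := markFirst_step_start h0 <;> exact ⟨h1, by simp [h2]⟩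
  | succ t ih =>
    obtain ⟨h1, h2⟩ := ih (le_trans (by exact_mod_cast Nat.le_succ _) ht)
    obtain ⟨h3, q, p, -, h4, -⟩ := markFirst_step
      (h.2 (t + 1) (lt_of_lt_of_le (by exact_mod_cast Nat.lt_succ_self _) ht)) h2
    exact ⟨h3.trans h1, by simp [h4]⟩

theorem markFirst_oneLimited : (markFirst B e).OneLimited := by
  intro w c T h t ht hne s hs
  -- An earlier visit means that this is not the first move, and only the first move changes the
  -- tape.
  obtain ⟨t, rfl⟩ := Nat.exists_eq_succ_of_ne_zero (Nat.ne_of_gt (Nat.zero_lt_of_lt hs))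
  exact absurd (congrFun (markFirst_step (h.2 _ ht) (markFirst_computation h t ht.le).2).1 _) hne

theorem markFirst_onceMarking : (markFirst B e).OnceMarking := by
  constructor
  · intro w c T h
    refine ⟨1, fun t ht i => ?_⟩
    rcases t with _ | t
    · exact .inl rfl
    · rw [(markFirst_computation h t ht).1, h.1, init_tape]
      beta_reduce
      by_cases hi : i = 1
      · subst hi
        rw [markedTape_self]
        cases tapeOf w 1 with
        -- `markSym` fixes the end-markers, so on the empty input, where cell 1 holds the right
        -- end-marker, nothing is marked.
        | left => exact .inl rfl
        | right => exact .inl rfl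
        | sym a => exact .inr ⟨rfl, a, rfl, rfl⟩
      · exact .inl (markedTape_of_ne w hi)
  · intro w c T hw h
    have hT : (1 : ℕ∞) ≤ T := by
      rw [Order.one_le_iff_ne_zero]
      rintro rfl
      obtain ⟨c', hc'⟩ := markFirst_exists_step (B := B) (e := e) w
      exact h.2 0 rfl c' (h.1.1 ▸ hc')
    refine ⟨1, by simpa using hT, 1, ?_⟩
    obtain ⟨a, w, rfl⟩ := List.exists_cons_of_ne_nil hw
    refine ⟨a, ?_⟩
    rw [(markFirst_computation h.1 0 (by simpa using hT)).1, markedTape_self]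
    rfl

theorem accepts_markFirst : (markFirst B e).accepts = B.accepts := by
  ext w
  rw [mem_accepts_iff]
  constructor
  · rintro ⟨c, h, hhead, q, hq, hstate⟩
    have key : ∀ c, ReflTransGen ((markFirst B e).Step w.length) ((markFirst B e).init w) c →
        c = (markFirst B e).init w ∨ (∀ i, eraseSym (c.tape i) = tapeOf w i) ∧
          (c.state = e.symm (some none) ∨ ∃ p, c.state = e.symm (some (some p)) ∧
            ReflTransGen (B.Step w) (B.start, 1) (p, c.head)) := by
      intro c hc
      induction hc with
      | refl => exact .inl rfl
      | tail _ hc ih =>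
        refine .inr ?_
        rcases ih with rfl | ⟨htape, ih⟩
        · obtain ⟨h1, h2⟩ := markFirst_step_start hc
          refine ⟨fun i => by rw [h1, eraseSym_markedTape], h2.imp_right ?_⟩
          rintro ⟨p, hp, hs⟩
          exact ⟨p, hp, .single hs⟩
        · obtain ⟨h1, q, p, hq, hp, hs⟩ := markFirst_step hc (by
            rcases ih with h | ⟨p, h, -⟩ <;> simp [h])
          refine ⟨fun i => by rw [h1, htape], .inr ⟨p, hp, ?_⟩⟩
          rcases ih with ih | ⟨q', hq', ih⟩
          · simp [hq] at ih
          · rw [hq] at hq'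
            simp only [EmbeddingLike.apply_eq_iff_eq, Option.some.injEq] at hq'
            subst hq'
            exact ih.tail (hs htape)
    rcases key c h with rfl | ⟨-, h | ⟨p, hp, h⟩⟩
    · simp [init] at hhead
    · simp [h] at hstate
    · rw [hp] at hstate
      simp only [EmbeddingLike.apply_eq_iff_eq, Option.some.injEq] at hstate
      subst hstate
      exact ⟨p, hq, hhead ▸ h⟩
  · rintro ⟨q, hq, h⟩
    have key : ∀ x, ReflTransGen (B.Step w) (B.start, 1) x → x = (B.start, 1) ∨
        ∃ c, ReflTransGen ((markFirst B e).Step w.length) ((markFirst B e).init w) c ∧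
          c.state = e.symm (some (some x.1)) ∧ c.head = x.2 ∧
            ∀ i, eraseSym (c.tape i) = tapeOf w i := by
      intro x hx
      induction hx with
      | refl => exact .inl rfl
      | @tail x y _ hxy ih =>
        refine .inr ?_
        rcases ih with rfl | ⟨c, hc, hstate, hhead, htape⟩
        · obtain ⟨hi, d, hd, hm⟩ := hxy
          refine ⟨⟨e.symm (some (some y.1)), y.2, markedTape w 1⟩,
            .single ⟨hi, markSym (tapeOf w 1), d, ?_, hm, ?_⟩, rfl, rfl, eraseSym_markedTape w 1⟩
          · rw [init_tape]
            refine mem_markFirst_δ_none.2 ?_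
            simp only at hd
            simp [init, eraseSym_plainSym, firstMove, hd]
          · rw [init_tape]
            rfl
        · exact ⟨_, hc.tail (markFirst_step_of hstate htape (hhead ▸ hxy)), rfl, rfl, htape⟩
    rcases key _ h with h | ⟨c, hc, hstate, hhead, -⟩
    · simp at h
    · exact ⟨c, hc, hhead, q, hq, hstate⟩

end FirstMark

theorem exists_onceMarking {α : Type u} {Q : Type v} [Finite Q] (B : TwoDFA α Q) :
    ∃ (m : ℕ) (A : OneLA α α (Fin m)), A.OneLimited ∧ A.Deterministic ∧ A.OnceMarking ∧
      m ≤ 3 * Nat.card Q ∧ A.accepts = B.accepts := by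
  refine ⟨_, markFirst B (Finite.equivFin (Option (Option Q))).symm, markFirst_oneLimited,
    markFirst_deterministic, markFirst_onceMarking, ?_, accepts_markFirst⟩
  have : Nonempty Q := ⟨B.start⟩
  have : 0 < Nat.card Q := Nat.card_pos
  -- The state count is `n + 2`, at most `3n` because `n ≥ 1`.
  simp only [Finite.card_option]
  omega


end OneLA

end LimitedAutomata
open LimitedAutomata in
theorem theorem5 :
    (∃ C : ℕ, ∀ (α : Type u) [Finite α] (Q : Type v) [Finite Q] (A : OneLA α α Q),
      A.OneLimited → A.Deterministic → A.MarksAtMostOneCell →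
        ∃ (m : ℕ) (B : TwoDFA α (Fin m)),
          m ≤ C * Nat.card Q ^ 3 ∧ B.accepts = A.accepts) ∧
    (∃ C : ℕ, ∀ (α : Type u) [Finite α] (Q : Type v) [Finite Q] (B : TwoDFA α Q),
      ∃ (m : ℕ) (A : OneLA α α (Fin m)),
        A.OneLimited ∧ A.Deterministic ∧ A.OnceMarking ∧
          m ≤ C * Nat.card Q ∧ A.accepts = B.accepts) :=
  ⟨⟨10, fun _ _ _ _ A hlim hdet hmark => A.exists_twoDFA hlim hdet hmark⟩,
    ⟨3, fun _ _ _ _ B => OneLA.exists_onceMarking B⟩⟩
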